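/- Let $q\in\mathbb C$ with $0<|q|<1$. Fix a value $\tau$ of $\log q$ and write $q^a=e^{a\tau}$. Let $\alpha,h_1,h_2,h_3,l_1,l_2,l_3\in\mathbb C$ and $t_1,t_2,t_3\in\mathbb C\setminus\{0\}$, and set $\lambda=(h_1+h_2+h_3-l_1-l_2-l_3+1)/2$. Functions of $x$ may be multivalued on $\mathbb C\setminus\{0\}$: they are functions of a value $u$ of $\log x$, with $x^a=e^{au}$, and $x\mapsto qx$, $x\mapsto x/q$ mean $u\mapsto u+\tau$, $u\mapsto u-\tau$. Write $(a;q)_n=\prod_{j=0}^{n-1}(1-aq^j)$, $(a;q)_\infty=\prod_{j\ge0}(1-aq^j)$, $(a_1,\dots,a_N;q)_\infty=\prod_k(a_k;q)_\infty$, and $$\Phi\binom{a_1,a_2,a_3,a_4}{b_1,b_2,b_3}=\frac{(b_1,b_2,b_3,q;q)_\infty}{(a_1,a_2,a_3,a_4;q)_\infty}\;{}_4\phi_3\!\left({a_1,a_2,a_3,a_4\atop b_1,b_2,b_3};q,q\right),\qquad {}_4\phi_3\!\left({a_1,\dots,a_4\atop b_1,b_2,b_3};q,z\right)=\sum_{n\ge0}\frac{(a_1;q)_n(a_2;q)_n(a_3;q)_n(a_4;q)_n}{(q;q)_n(b_1;q)_n(b_2;q)_n(b_3;q)_n}z^n,$$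 which is defined when none of the $a_k,b_k$ belongs to $\{q^{-n}:n=0,1,2,\dots\}$. For $\{i,i',i''\}=\{1,2,3\}$ put $$g_i^{\langle1\rangle}(x)=x^{-\alpha}q^{l_i-1/2}t_i\,\Phi\binom{q^{l_i+1/2}t_i/x,\ q^{\lambda+l_i-h_i},\ q^{\lambda+l_i-h_{i'}}t_i/t_{i'},\ q^{\lambda+l_i-h_{i''}}t_i/t_{i''}}{q^{\lambda+l_i+1/2}t_i/x,\ q^{l_i-l_{i'}+1}t_i/t_{i'},\ q^{l_i-l_{i''}+1}t_i/t_{i''}},$$ $$g_i^{\langle2\rangle}(x)=x^{\lambda-\alpha}\frac{q^{\lambda-h_i-1/2}}{t_i}\,\Phi\binom{xq^{-h_i+1/2}/t_i,\ q^{\lambda+l_i-h_i},\ q^{\lambda+l_{i'}-h_i}t_{i'}/t_i,\ q^{\lambda+l_{i''}-h_i}t_{i''}/t_i}{xq^{\lambda-h_i+1/2}/t_i,\ q^{h_{i'}-h_i+1}t_{i'}/t_i,\ q^{h_{i''}-h_i+1}t_{i''}/t_i},$$ and $$g_0^{\langle1\rangle}(x)=x^{1-\alpha}q^{-\lambda}\,\Phi\binom{xq^{-h_1+1/2}/t_1,\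 xq^{-h_2+1/2}/t_2,\ xq^{-h_3+1/2}/t_3,\ q^{1-\lambda}}{xq^{-\lambda-l_1+3/2}/t_1,\ xq^{-\lambda-l_2+3/2}/t_2,\ xq^{-\lambda-l_3+3/2}/t_3},$$ $$g_0^{\langle2\rangle}(x)=x^{\lambda-\alpha-1}\,\Phi\binom{q^{l_1+1/2}t_1/x,\ q^{l_2+1/2}t_2/x,\ q^{l_3+1/2}t_3/x,\ q^{1-\lambda}}{q^{-\lambda+h_1+3/2}t_1/x,\ q^{-\lambda+h_2+3/2}t_2/x,\ q^{-\lambda+h_3+3/2}t_3/x}.$$ Let $i,j\in\{0,1,2,3\}$. Then $g=g_i^{\langle1\rangle}-g_j^{\langle1\rangle}$ satisfies the variant of the $q$-hypergeometric equation of degree three $$\begin{aligned}&\prod_{k=1}^3\bigl(x-q^{h_k+1/2}t_k\bigr)\,g(x/q)+q^{2\alpha+1}\prod_{k=1}^3\bigl(x-q^{l_k-1/2}t_k\bigr)\,g(qx)\\&+q^{\alpha}\Bigl[-(q+1)x^3+q^{1/2}\bigl\{(q^{h_1}+q^{l_1})t_1+(q^{h_2}+q^{l_2})t_2+(q^{h_3}+q^{l_3})t_3\bigr\}x^2\\&\quad-q^{(h_1+h_2+h_3+l_1+l_2+l_3+1)/2}\bigl\{(q^{-h_1}+q^{-l_1})t_2t_3+(q^{-h_2}+q^{-l_2})t_1t_3+(q^{-h_3}+q^{-l_3})t_1t_2\bigr\}x\\&\quad+q^{(h_1+h_2+h_3+l_1+l_2+l_3)/2}(q+1)t_1t_2t_3\Bigr]g(x)=0\end{aligned}$$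 at every $x$ such that the expressions defining $g_i^{\langle1\rangle}$ and $g_j^{\langle1\rangle}$ are defined at $x/q$, $x$ and $qx$. Likewise $g=g_i^{\langle2\rangle}-g_j^{\langle2\rangle}$ satisfies the same equation at every $x$ such that the expressions defining $g_i^{\langle2\rangle}$ and $g_j^{\langle2\rangle}$ are defined at $x/q$, $x$ and $qx$. -/

import Mathlib

open scoped BigOperators

noncomputable section

namespace QHyp

/-- The power `q ^ a = exp (a * τ)`, where `τ` is the chosen value of `log q`. -/
def qpow (τ a : ℂ) : ℂ := Complex.exp (a * τ)

/-- The finite `q`-shifted factorial `(a; q)_n`. -/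
def qPoch (q a : ℂ) (n : ℕ) : ℂ := ∏ j ∈ Finset.range n, (1 - a * q ^ j)

/-- The infinite product `(a; q)_∞`, used for `‖q‖ < 1`, where it converges absolutely. -/
def qPochInf (q a : ℂ) : ℂ := ∏' j : ℕ, (1 - q ^ j * a)

/-- The basic hypergeometric series `₄φ₃(a; b; q, z)`. -/
def phi43 (a : Fin 4 → ℂ) (b : Fin 3 → ℂ) (q z : ℂ) : ℂ :=
  ∑' n : ℕ, (∏ k, qPoch q (a k) n) / (qPoch q q n * ∏ k, qPoch q (b k) n) * z ^ n

/-- `(b₁, b₂, b₃, q; q)_∞ / (a₁, a₂, a₃, a₄; q)_∞ * ₄φ₃(a; b; q, q)`. -/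
def Phi (q : ℂ) (a : Fin 4 → ℂ) (b : Fin 3 → ℂ) : ℂ :=
  ((∏ k, qPochInf q (b k)) * qPochInf q q) / (∏ k, qPochInf q (a k)) * phi43 a b q q

/-- No denominator in the expression `Phi q a b` vanishes: none of the `a k` (denominators of the
infinite products) and none of the `b k` (denominators of the series) is of the form `q ^ (-n)`
with `n = 0, 1, 2, …`. -/
def PhiDefined (q : ℂ) (a : Fin 4 → ℂ) (b : Fin 3 → ℂ) : Prop :=
  (∀ k, ∀ n : ℕ, a k * q ^ n ≠ 1) ∧ (∀ k, ∀ n : ℕ, b k * q ^ n ≠ 1)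

/-- `λ = (h₁ + h₂ + h₃ - l₁ - l₂ - l₃ + 1) / 2`. -/
def lam (h l : Fin 3 → ℂ) : ℂ := (h 0 + h 1 + h 2 - l 0 - l 1 - l 2 + 1) / 2

/-! In what follows the indices `0, 1, 2 : Fin 3` of the parameters stand for `1, 2, 3`.
Because of the powers of `x`, functions of `x ≠ 0` are written as functions of the
logarithm `u` of `x`: `x = exp u`, `x ^ a = exp (a * u)`, and `x ↦ q x`, `x ↦ x / q` are
`u ↦ u + τ`, `u ↦ u - τ`. -/

/-- The upper parameters of the series in the function with index `i` of the first family. -/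
def upper1 (τ : ℂ) (h l t : Fin 3 → ℂ) (i : Fin 4) (u : ℂ) : Fin 4 → ℂ :=
  let x := Complex.exp u
  let lm := lam h l
  let e : Fin 3 → Fin 4 → ℂ := fun k =>
    ![qpow τ (l k + 1 / 2) * t k / x,
      qpow τ (lm + l k - h k),
      qpow τ (lm + l k - h (k + 1)) * t k / t (k + 1),
      qpow τ (lm + l k - h (k + 2)) * t k / t (k + 2)]
  ![![x * qpow τ (-h 0 + 1 / 2) / t 0,
      x * qpow τ (-h 1 + 1 / 2) / t 1,
      x * qpow τ (-h 2 + 1 / 2) / t 2,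
      qpow τ (-lm + 1)],
    e 0, e 1, e 2] i

/-- The lower parameters of the series in the function with index `i` of the first family. -/
def lower1 (τ : ℂ) (h l t : Fin 3 → ℂ) (i : Fin 4) (u : ℂ) : Fin 3 → ℂ :=
  let x := Complex.exp u
  let lm := lam h l
  let e : Fin 3 → Fin 3 → ℂ := fun k =>
    ![qpow τ (lm + l k + 1 / 2) * t k / x,
      qpow τ (l k - l (k + 1) + 1) * t k / t (k + 1),
      qpow τ (l k - l (k + 2) + 1) * t k / t (k + 2)]
  ![![x * qpow τ (-lm - l 0 + 3 / 2) / t 0,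
      x * qpow τ (-lm - l 1 + 3 / 2) / t 1,
      x * qpow τ (-lm - l 2 + 3 / 2) / t 2],
    e 0, e 1, e 2] i

/-- The elementary factor of the function with index `i` of the first family. -/
def factor1 (τ α : ℂ) (h l t : Fin 3 → ℂ) (i : Fin 4) (u : ℂ) : ℂ :=
  let e : Fin 3 → ℂ := fun k =>
    Complex.exp (-α * u) * qpow τ (l k - 1 / 2) * t k
  ![Complex.exp ((1 - α) * u) * qpow τ (-lam h l), e 0, e 1, e 2] i

/-- The function `g_i^⟨1⟩`, for `i = 0, 1, 2, 3`. -/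
def g1 (q τ α : ℂ) (h l t : Fin 3 → ℂ) (i : Fin 4) (u : ℂ) : ℂ :=
  factor1 τ α h l t i u * Phi q (upper1 τ h l t i u) (lower1 τ h l t i u)

/-- No denominator vanishes in the defining expression of `g_i^⟨1⟩` at `x = exp u`. -/
def Defined1 (q τ : ℂ) (h l t : Fin 3 → ℂ) (i : Fin 4) (u : ℂ) : Prop :=
  PhiDefined q (upper1 τ h l t i u) (lower1 τ h l t i u)

/-- The upper parameters of the series in the function with index `i` of the second family. -/
def upper2 (τ : ℂ) (h l t : Fin 3 → ℂ) (i : Fin 4) (u : ℂ) : Fin 4 → ℂ :=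
  let x := Complex.exp u
  let lm := lam h l
  let e : Fin 3 → Fin 4 → ℂ := fun k =>
    ![x * qpow τ (-h k + 1 / 2) / t k,
      qpow τ (lm + l k - h k),
      qpow τ (lm + l (k + 1) - h k) * t (k + 1) / t k,
      qpow τ (lm + l (k + 2) - h k) * t (k + 2) / t k]
  ![![qpow τ (l 0 + 1 / 2) * t 0 / x,
      qpow τ (l 1 + 1 / 2) * t 1 / x,
      qpow τ (l 2 + 1 / 2) * t 2 / x,
      qpow τ (1 - lm)],
    e 0, e 1, e 2] i

/-- The lower parameters of the series in the function with index `i` of the second family. -/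
def lower2 (τ : ℂ) (h l t : Fin 3 → ℂ) (i : Fin 4) (u : ℂ) : Fin 3 → ℂ :=
  let x := Complex.exp u
  let lm := lam h l
  let e : Fin 3 → Fin 3 → ℂ := fun k =>
    ![x * qpow τ (lm - h k + 1 / 2) / t k,
      qpow τ (h (k + 1) - h k + 1) * t (k + 1) / t k,
      qpow τ (h (k + 2) - h k + 1) * t (k + 2) / t k]
  ![![qpow τ (-lm + h 0 + 3 / 2) * t 0 / x,
      qpow τ (-lm + h 1 + 3 / 2) * t 1 / x,
      qpow τ (-lm + h 2 + 3 / 2) * t 2 / x],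
    e 0, e 1, e 2] i

/-- The elementary factor of the function with index `i` of the second family. -/
def factor2 (τ α : ℂ) (h l t : Fin 3 → ℂ) (i : Fin 4) (u : ℂ) : ℂ :=
  let lm := lam h l
  let e : Fin 3 → ℂ := fun k =>
    Complex.exp ((lm - α) * u) * (qpow τ (lm - h k - 1 / 2) / t k)
  ![Complex.exp ((lm - α - 1) * u), e 0, e 1, e 2] i

/-- The function `g_i^⟨2⟩`, for `i = 0, 1, 2, 3`. -/
def g2 (q τ α : ℂ) (h l t : Fin 3 → ℂ) (i : Fin 4) (u : ℂ) : ℂ :=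
  factor2 τ α h l t i u * Phi q (upper2 τ h l t i u) (lower2 τ h l t i u)

/-- No denominator vanishes in the defining expression of `g_i^⟨2⟩` at `x = exp u`. -/
def Defined2 (q τ : ℂ) (h l t : Fin 3 → ℂ) (i : Fin 4) (u : ℂ) : Prop :=
  PhiDefined q (upper2 τ h l t i u) (lower2 τ h l t i u)

/-- The function `g` satisfies the variant of the `q`-hypergeometric equation of degree three
at the point `x = exp u`. -/
def SolvesDegThree (q τ α : ℂ) (h l t : Fin 3 → ℂ) (g : ℂ → ℂ) (u : ℂ) : Prop :=
  let x := Complex.exp u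
  (x - qpow τ (h 0 + 1 / 2) * t 0) * (x - qpow τ (h 1 + 1 / 2) * t 1)
      * (x - qpow τ (h 2 + 1 / 2) * t 2) * g (u - τ)
    + qpow τ (2 * α + 1) * (x - qpow τ (l 0 - 1 / 2) * t 0) * (x - qpow τ (l 1 - 1 / 2) * t 1)
      * (x - qpow τ (l 2 - 1 / 2) * t 2) * g (u + τ)
    + qpow τ α *
      (-(q + 1) * x ^ 3
        + qpow τ (1 / 2) *
          ((qpow τ (h 0) + qpow τ (l 0)) * t 0 + (qpow τ (h 1) + qpow τ (l 1)) * t 1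
            + (qpow τ (h 2) + qpow τ (l 2)) * t 2) * x ^ 2
        - qpow τ ((h 0 + h 1 + h 2 + l 0 + l 1 + l 2 + 1) / 2) *
          ((qpow τ (-h 0) + qpow τ (-l 0)) * t 1 * t 2
            + (qpow τ (-h 1) + qpow τ (-l 1)) * t 0 * t 2
            + (qpow τ (-h 2) + qpow τ (-l 2)) * t 0 * t 1) * x
        + qpow τ ((h 0 + h 1 + h 2 + l 0 + l 1 + l 2) / 2) * (q + 1) * t 0 * t 1 * t 2)
      * g u = 0

end QHyp

end

open scoped Topology
open Filter QHyp

/-! ### The infinite `q`-shifted factorial -/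

/-! Put `r = q^(1/2)`, `y = q^λ`, `a k = q^(h k) t k`, `b k = q^(l k) t k`. Apart from the factor
`x^(-α) / r`, every function of the first family is a one-sided Jackson sum of `s * integrand x s`
over a lattice `s = ξ q^n`, `n ≥ 0`. The integrand is the same for all four; only the starting point
changes: `ξ = b k` for the indices 1, 2, 3 and `ξ = x r / y` for the index 0 (`hasSum_jackson`).

Let `L` be the operator of the equation with the powers of `q^α` removed. Applied in `x` to `s *
integrand x s`, it gives an exact `q`-difference `primitive (q s) - primitive s`
(`operator_integrand`), which comes down to a rational identity using the balancing relation `a₀ a₁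
a₂ q = y² b₀ b₁ b₂`. The sum therefore telescopes. The limit of the primitive along the lattice is
`x b₀ b₁ b₂ (1 - y)`, whatever the lattice, and the primitive vanishes at `s = b k`. For index 0 the
lattice moves with `x`, and the boundary terms are shown to cancel. So all four functions solve one
and the same inhomogeneous equation (`operator_jackson`), and differences solve the homogeneous one.

The second family is the image of the first under `x ↦ 1/x`, `(h, l, t, α) ↦ (-l, -h, 1/t, λ - α)`.
This fixes `λ`, exchanges the two shifts and preserves the equation up to a nonzero factor (`g2_eq`,
`solvesDegThree_inversion`). -/

lemma summable_norm_pow_mul {q : ℂ} (hq : ‖q‖ < 1) (a : ℂ) :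
    Summable fun j : ℕ => ‖-(q ^ j * a)‖ := by
  simp only [norm_neg, norm_mul, norm_pow]
  exact (summable_geometric_of_lt_one (norm_nonneg _) hq).mul_right _

lemma multipliable_one_sub_pow_mul {q : ℂ} (hq : ‖q‖ < 1) (a : ℂ) :
    Multipliable fun j : ℕ => 1 - q ^ j * a := by
  simpa [sub_eq_add_neg] using multipliable_one_add_of_summable (summable_norm_pow_mul hq a)

lemma qPochInf_step {q : ℂ} (hq : ‖q‖ < 1) (a : ℂ) :
    qPochInf q a = (1 - a) * qPochInf q (q * a) := by
  have hs : (fun j : ℕ => 1 - q ^ (j + 1) * a) = fun j : ℕ => 1 - q ^ j * (q * a) := by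
    ext j; ring
  have hm : Multipliable fun j : ℕ => 1 - q ^ (j + 1) * a := by
    rw [hs]; exact multipliable_one_sub_pow_mul hq _
  unfold qPochInf
  rw [tprod_eq_zero_mul' (f := fun j : ℕ => 1 - q ^ j * a) hm, hs]
  simp

lemma qPochInf_eq_qPoch_mul {q : ℂ} (hq : ‖q‖ < 1) (a : ℂ) (n : ℕ) :
    qPochInf q a = qPoch q a n * qPochInf q (a * q ^ n) := by
  induction n with
  | zero => simp [qPoch]
  | succ n ih =>
    rw [ih, qPochInf_step hq (a * q ^ n)]
    simp only [qPoch, Finset.prod_range_succ]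
    rw [show q * (a * q ^ n) = a * q ^ (n + 1) by ring]
    ring

lemma qPochInf_ne_zero {q : ℂ} (hq : ‖q‖ < 1) {a : ℂ} (ha : ∀ n : ℕ, a * q ^ n ≠ 1) :
    qPochInf q a ≠ 0 := by
  have := tprod_one_add_ne_zero_of_summable (f := fun j : ℕ => -(q ^ j * a))
    (fun j => by
      rw [← sub_eq_add_neg, sub_ne_zero, mul_comm]
      exact (ha j).symm) (summable_norm_pow_mul hq a)
  simpa [qPochInf, sub_eq_add_neg] using this

lemma qPoch_ne_zero {q a : ℂ} (ha : ∀ n : ℕ, a * q ^ n ≠ 1) (n : ℕ) : qPoch q a n ≠ 0 :=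
  Finset.prod_ne_zero_iff.2 fun j _ => sub_ne_zero.2 (ha j).symm

lemma tendsto_qPochInf_mul_pow {q : ℂ} (hq : ‖q‖ < 1) (a : ℂ) :
    Tendsto (fun n : ℕ => qPochInf q (a * q ^ n)) atTop (𝓝 1) := by
  have h := tendsto_tprod_one_add_of_dominated_convergence (𝓕 := atTop)
    (f := fun (n : ℕ) (j : ℕ) => -(q ^ j * (a * q ^ n))) (g := 0)
    (bound := fun j => ‖-(q ^ j * a)‖) (summable_norm_pow_mul hq a) ?_ ?_
  · simpa [qPochInf, sub_eq_add_neg] using h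
  · intro j
    have := ((tendsto_pow_atTop_nhds_zero_of_norm_lt_one hq).const_mul (q ^ j * a)).neg
    simpa [mul_assoc] using this
  · refine Eventually.of_forall fun n j => ?_
    simp only [norm_neg, norm_mul, norm_pow]
    have : ‖q‖ ^ n ≤ 1 := pow_le_one₀ (norm_nonneg _) hq.le
    have h0 : 0 ≤ ‖q‖ ^ j * ‖a‖ := by positivity
    nlinarith

lemma mul_pow_ne_one_mul {q a : ℂ} (ha : ∀ n : ℕ, a * q ^ n ≠ 1) (n : ℕ) :
    ∀ m : ℕ, a * q ^ n * q ^ m ≠ 1 := fun m => by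
  rw [mul_assoc, ← pow_add]; exact ha _

lemma self_mul_pow_ne_one {q : ℂ} (hq : ‖q‖ < 1) (n : ℕ) : q * q ^ n ≠ 1 := by
  intro h
  have h1 := congrArg norm h
  rw [← pow_succ', norm_pow, norm_one] at h1
  exact absurd h1 (pow_lt_one₀ (norm_nonneg _) hq (Nat.succ_ne_zero _)).ne

/-! ### `Phi` as a series -/

/-- The ratio of infinite products which, weighted by `q ^ n`, is the `n`-th term of `Phi`. -/
noncomputable def phiWeight (q : ℂ) (a : Fin 4 → ℂ) (b : Fin 3 → ℂ) (n : ℕ) : ℂ :=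
  (∏ k, qPochInf q (b k * q ^ n)) * qPochInf q (q * q ^ n) / ∏ k, qPochInf q (a k * q ^ n)

lemma tendsto_phiWeight {q : ℂ} (hq : ‖q‖ < 1) (a : Fin 4 → ℂ) (b : Fin 3 → ℂ) :
    Tendsto (phiWeight q a b) atTop (𝓝 1) := by
  have hb := tendsto_finsetProd Finset.univ fun (k : Fin 3) _ => tendsto_qPochInf_mul_pow hq (b k)
  have ha := tendsto_finsetProd Finset.univ fun (k : Fin 4) _ => tendsto_qPochInf_mul_pow hq (a k)
  have := (hb.mul (tendsto_qPochInf_mul_pow hq q)).div ha (by simp)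
  simp only [Finset.prod_const_one, one_mul, div_one] at this
  exact this

lemma summable_pow_mul_of_tendsto {q : ℂ} (hq : ‖q‖ < 1) {w : ℕ → ℂ} {c : ℂ}
    (hw : Tendsto w atTop (𝓝 c)) : Summable fun n : ℕ => q ^ n * w n := by
  refine summable_of_isBigO_nat (summable_geometric_of_lt_one (norm_nonneg _) hq) ?_
  have h1 : (fun n : ℕ => q ^ n) =O[atTop] fun n : ℕ => ‖q‖ ^ n :=
    Asymptotics.isBigO_of_le _ fun n => by simp
  simpa using h1.mul (hw.isBigO_one ℝ)

/-- Since `(c;q)_∞ = (c;q)_n (c q^n;q)_∞`, the prefactor of `Phi` absorbs all finite factorials. The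
weights tend to 1, so the series converges like a geometric one. -/
lemma hasSum_Phi {q : ℂ} (hq : ‖q‖ < 1) {a : Fin 4 → ℂ} {b : Fin 3 → ℂ}
    (hd : PhiDefined q a b) : HasSum (fun n : ℕ => q ^ n * phiWeight q a b n) (Phi q a b) := by
  have key : ∀ n : ℕ, q ^ n * phiWeight q a b n =
      ((∏ k, qPochInf q (b k)) * qPochInf q q) / (∏ k, qPochInf q (a k)) *
        ((∏ k, qPoch q (a k) n) / (qPoch q q n * ∏ k, qPoch q (b k) n) * q ^ n) := by
    intro n
    have ha : ∏ k, qPochInf q (a k) =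
        (∏ k, qPoch q (a k) n) * ∏ k, qPochInf q (a k * q ^ n) := by
      rw [← Finset.prod_mul_distrib]
      exact Finset.prod_congr rfl fun k _ => qPochInf_eq_qPoch_mul hq _ n
    have hb : ∏ k, qPochInf q (b k) =
        (∏ k, qPoch q (b k) n) * ∏ k, qPochInf q (b k * q ^ n) := by
      rw [← Finset.prod_mul_distrib]
      exact Finset.prod_congr rfl fun k _ => qPochInf_eq_qPoch_mul hq _ n
    have ha0 : ∏ k, qPoch q (a k) n ≠ 0 :=
      Finset.prod_ne_zero_iff.2 fun k _ => qPoch_ne_zero (hd.1 k) n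
    have hb0 : ∏ k, qPoch q (b k) n ≠ 0 :=
      Finset.prod_ne_zero_iff.2 fun k _ => qPoch_ne_zero (hd.2 k) n
    have hq0 : qPoch q q n ≠ 0 := qPoch_ne_zero (self_mul_pow_ne_one hq) n
    have hA0 : ∏ k, qPochInf q (a k * q ^ n) ≠ 0 :=
      Finset.prod_ne_zero_iff.2 fun k _ => qPochInf_ne_zero hq (mul_pow_ne_one_mul (hd.1 k) n)
    rw [ha, hb, qPochInf_eq_qPoch_mul hq q n, phiWeight]
    field_simp
  have hs := summable_pow_mul_of_tendsto hq (tendsto_phiWeight hq a b)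
  have := hs.hasSum
  convert this using 1
  simp_rw [key, tsum_mul_left]
  rfl

lemma hasSum_eq_of_telescoping {T G : ℕ → ℂ} {S c : ℂ} (hT : HasSum T S)
    (hG : ∀ n, T n = G (n + 1) - G n) (hc : Tendsto G atTop (𝓝 c)) : S = c - G 0 := by
  have h1 := hT.tendsto_sum_nat
  simp_rw [hG, Finset.sum_range_sub] at h1
  exact tendsto_nhds_unique h1 (hc.sub_const _)

/-! ### Algebraic identities behind the `q`-difference equation -/

/-- The coefficient of `g(x)` in the degree three equation, in terms of `a k = q ^ h k * t k` and
`b k = q ^ l k * t k`, where `r ^ 2 = q` and `y = q ^ lam h l`. -/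
noncomputable def midCoeff (q r y x : ℂ) (a b : Fin 3 → ℂ) : ℂ :=
  -(q + 1) * x ^ 3 + r * (a 0 + b 0 + (a 1 + b 1) + (a 2 + b 2)) * x ^ 2
  - y * (b 0 * b 1 * b 2) * ((1 / a 0 + 1 / b 0) + (1 / a 1 + 1 / b 1) + (1 / a 2 + 1 / b 2)) * x
  + y / r * (q + 1) * (b 0 * b 1 * b 2)

/-- This is the difference equation for the integrand divided by `integrandConst` at `s` times `(q y
r s/x;q)_∞ / (s/(r x);q)_∞`. The balancing relation `hab` is used to eliminate `b 0`; what remains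
is an identity of rational functions in free variables. -/
lemma telescoping_identity {q r y x s : ℂ} {a b : Fin 3 → ℂ} (hr : r ^ 2 = q) (hr0 : r ≠ 0)
    (hy : y ≠ 0) (hx : x ≠ 0) (ha : ∀ k, a k ≠ 0) (hb : ∀ k, b k ≠ 0)
    (hab : a 0 * a 1 * a 2 * q = y ^ 2 * (b 0 * b 1 * b 2)) :
    s * ((∏ k, (x - r * a k)) * ((1 - s / (r * x)) * (1 - r * s / x))
      + q * (∏ k, (x - b k / r)) * ((1 - y * s / (r * x)) * (1 - y * r * s / x))
      + midCoeff q r y x a b * ((1 - y * r * s / x) * (1 - s / (r * x))))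
    = x * (b 0 * b 1 * b 2) * (1 - y) *
      ((∏ k, (1 - y * s / a k)) * (1 - s / (r * x)) - (∏ k, (1 - s / b k)) * (1 - y * r * s / x)) := by
  have h0 := ha 0
  have h1 := ha 1
  have h2 := ha 2
  have g0 := hb 0
  have g1 := hb 1
  have g2 := hb 2
  subst hr
  have e : b 0 = a 0 * a 1 * a 2 * r ^ 2 / (y ^ 2 * b 1 * b 2) := by
    field_simp; linear_combination - hab
  simp only [Fin.prod_univ_three, midCoeff]
  rw [e]
  generalize a 0 = a0 at *
  generalize a 1 = a1 at *
  generalize a 2 = a2 at *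
  generalize b 1 = b1 at *
  generalize b 2 = b2 at *
  clear e hab
  field_simp
  ring

/-- The first telescoping step for the index 0, at `s = x r / y`. The `q x` term is absent because
its lattice starts one step later; the last product is the boundary term from `x / q`, whose lattice
starts one step earlier. -/
lemma initial_identity {q r y x : ℂ} {a b : Fin 3 → ℂ} (hr : r ^ 2 = q) (hr0 : r ≠ 0)
    (hy : y ≠ 0) (hx : x ≠ 0) (ha : ∀ k, a k ≠ 0) (hb : ∀ k, b k ≠ 0)
    (hab : a 0 * a 1 * a 2 * q = y ^ 2 * (b 0 * b 1 * b 2)) :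
    (x * r / y) * ((∏ k, (x - r * a k)) * (1 - q / y) + midCoeff q r y x a b * (1 - q))
    = x * (b 0 * b 1 * b 2) * (1 - y) * (∏ k, (1 - x * r / a k)) +
      (∏ k, (r * a k)) * (x * r / y / q) * (1 - q) * ∏ k, (1 - x * r / y / b k) := by
  have h0 := ha 0
  have h1 := ha 1
  have h2 := ha 2
  have g0 := hb 0
  have g1 := hb 1
  have g2 := hb 2
  subst hr
  have e : b 0 = a 0 * a 1 * a 2 * r ^ 2 / (y ^ 2 * b 1 * b 2) := by
    field_simp; linear_combination - hab
  simp only [Fin.prod_univ_three, midCoeff]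
  rw [e]
  generalize a 0 = a0 at *
  generalize a 1 = a1 at *
  generalize a 2 = a2 at *
  generalize b 1 = b1 at *
  generalize b 2 = b2 at *
  clear e hab
  field_simp
  ring

/-! ### The integrand of the Jackson integral -/

/-- The factor of the integrand that does not depend on `x`. -/
noncomputable def integrandConst (q y : ℂ) (a b : Fin 3 → ℂ) (s : ℂ) : ℂ :=
  ∏ k, (qPochInf q (q * s / b k) / qPochInf q (y * s / a k))

/-- The integrand of the Jackson integrals. -/
noncomputable def integrand (q r y : ℂ) (a b : Fin 3 → ℂ) (x s : ℂ) : ℂ :=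
  integrandConst q y a b s * (qPochInf q (y * r * s / x) / qPochInf q (r * s / x))

/-- The primitive of the image of the integrand under the `q`-difference operator. -/
noncomputable def primitive (q r y : ℂ) (a b : Fin 3 → ℂ) (x s : ℂ) : ℂ :=
  x * (b 0 * b 1 * b 2) * (1 - y) * (∏ k, (1 - s / b k)) * integrandConst q y a b s *
    (qPochInf q (y * r * s / x) / qPochInf q (s / (r * x)))

/-- Kept free of division by `1 - q s / b k`, so that only the denominators need to be nonzero. The
product on the left is the one built into `primitive` at `q s`. -/
lemma integrandConst_step {q y : ℂ} (hq : ‖q‖ < 1) {a b : Fin 3 → ℂ} {s : ℂ}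
    (hs : ∀ k, qPochInf q (y * s / a k) ≠ 0) :
    (∏ k, (1 - q * s / b k)) * integrandConst q y a b (q * s) =
      (∏ k, (1 - y * s / a k)) * integrandConst q y a b s := by
  simp only [integrandConst, ← Finset.prod_mul_distrib]
  refine Finset.prod_congr rfl fun k _ => ?_
  have h1 := qPochInf_step hq (q * s / b k)
  have h2 := qPochInf_step hq (y * s / a k)
  have h3 := hs k
  rw [h2] at h3
  have h4 := left_ne_zero_of_mul h3
  have h5 := right_ne_zero_of_mul h3
  rw [h1, h2, show q * (q * s) / b k = q * (q * s / b k) by ring,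
    show y * (q * s) / a k = q * (y * s / a k) by ring]
  generalize 1 - y * s / a k = u at *
  generalize qPochInf q (q * (y * s / a k)) = v at *
  field_simp

lemma operator_integrand {q r y x s : ℂ} (hq : ‖q‖ < 1) {a b : Fin 3 → ℂ} (hr : r ^ 2 = q)
    (hr0 : r ≠ 0) (hy : y ≠ 0) (hx : x ≠ 0) (ha : ∀ k, a k ≠ 0) (hb : ∀ k, b k ≠ 0)
    (hab : a 0 * a 1 * a 2 * q = y ^ 2 * (b 0 * b 1 * b 2))
    (hs : ∀ k, qPochInf q (y * s / a k) ≠ 0) (hs' : qPochInf q (s / (r * x)) ≠ 0) :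
    (∏ k, (x - r * a k)) * (s * integrand q r y a b (x / q) s)
      + q * (∏ k, (x - b k / r)) * (s * integrand q r y a b (q * x) s)
      + midCoeff q r y x a b * (s * integrand q r y a b x s)
    = primitive q r y a b x (q * s) - primitive q r y a b x s := by
  have hq0 : q ≠ 0 := by rw [← hr]; exact pow_ne_zero _ hr0
  have hid := telescoping_identity (s := s) hr hr0 hy hx ha hb hab
  have hst := integrandConst_step (b := b) hq hs
  have d1 := qPochInf_step hq (s / (r * x))
  have d2 := qPochInf_step hq (r * s / x)
  have n1 := qPochInf_step hq (y * s / (r * x))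
  have n2 := qPochInf_step hq (y * r * s / x)
  rw [show q * (s / (r * x)) = r * s / x by rw [← hr]; field_simp] at d1
  rw [show q * (y * s / (r * x)) = y * r * s / x by rw [← hr]; field_simp] at n1
  rw [d1, d2] at hs'
  have e1 := left_ne_zero_of_mul hs'
  have e2 := left_ne_zero_of_mul (right_ne_zero_of_mul hs')
  have e3 := right_ne_zero_of_mul (right_ne_zero_of_mul hs')
  simp only [integrand, primitive]
  rw [show y * r * s / (x / q) = q * (y * r * s / x) by field_simp,
    show r * s / (x / q) = q * (r * s / x) by field_simp,
    show y * r * s / (q * x) = y * s / (r * x) by rw [← hr]; field_simp,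
    show r * s / (q * x) = s / (r * x) by rw [← hr]; field_simp,
    show y * r * (q * s) / x = q * (y * r * s / x) by ring,
    show q * s / (r * x) = r * s / x by rw [← hr]; field_simp]
  rw [n1, d1, n2, d2]
  rw [mul_assoc (x * (b 0 * b 1 * b 2) * (1 - y)) (∏ k, (1 - q * s / b k)), hst]
  generalize integrandConst q y a b s = p at *
  generalize qPochInf q (q * (y * r * s / x)) = N at *
  generalize qPochInf q (q * (r * s / x)) = D at *
  generalize (∏ k, (x - r * a k)) = A at *
  generalize (∏ k, (x - b k / r)) = B at *
  generalize midCoeff q r y x a b = C at *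
  generalize (∏ k, (1 - y * s / a k)) = X at *
  generalize (∏ k, (1 - s / b k)) = Y at *
  generalize x * (b 0 * b 1 * b 2) * (1 - y) = c at *
  generalize 1 - s / (r * x) = E at *
  generalize 1 - r * s / x = F at *
  generalize 1 - y * r * s / x = K at *
  generalize 1 - y * s / (r * x) = M at *
  field_simp
  linear_combination p * N * hid

/-- Every infinite product tends to 1, so the limit does not see the starting point `s`. -/
lemma tendsto_primitive {q r y x s : ℂ} (hq : ‖q‖ < 1) (a b : Fin 3 → ℂ) :
    Tendsto (fun n : ℕ => primitive q r y a b x (s * q ^ n)) atTop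
      (𝓝 (x * (b 0 * b 1 * b 2) * (1 - y))) := by
  have hz : Tendsto (fun n : ℕ => q ^ n) atTop (𝓝 0) := tendsto_pow_atTop_nhds_zero_of_norm_lt_one hq
  have h1 : Tendsto (fun n : ℕ => ∏ k, (1 - s * q ^ n / b k)) atTop (𝓝 (∏ _k : Fin 3, 1)) := by
    refine tendsto_finsetProd _ fun k _ => ?_
    simpa using (((hz.const_mul s).div_const (b k)).const_sub 1)
  have h2 : Tendsto (fun n : ℕ => integrandConst q y a b (s * q ^ n)) atTop
      (𝓝 (∏ _k : Fin 3, 1)) := by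
    refine tendsto_finsetProd _ fun k _ => ?_
    have u := (tendsto_qPochInf_mul_pow hq (q * s / b k)).div
      (tendsto_qPochInf_mul_pow hq (y * s / a k)) one_ne_zero
    rw [div_one] at u
    refine u.congr fun n => ?_
    simp only [Pi.div_apply]
    congr 2 <;> ring
  have h3 : Tendsto (fun n : ℕ => qPochInf q (y * r * (s * q ^ n) / x) /
      qPochInf q (s * q ^ n / (r * x))) atTop (𝓝 1) := by
    have u := (tendsto_qPochInf_mul_pow hq (y * r * s / x)).div
      (tendsto_qPochInf_mul_pow hq (s / (r * x))) one_ne_zero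
    rw [div_one] at u
    refine u.congr fun n => ?_
    simp only [Pi.div_apply]
    congr 2 <;> ring
  simpa [primitive] using ((h1.const_mul (x * (b 0 * b 1 * b 2) * (1 - y))).mul h2).mul h3

/-! ### The Jackson integrals -/

/-- The starting points of the Jackson integrals. -/
noncomputable def startPt (r y : ℂ) (b : Fin 3 → ℂ) (i : Fin 4) (x : ℂ) : ℂ :=
  ![x * r / y, b 0, b 1, b 2] i

/-- The upper parameters of the series of the Jackson integral with index `i`. -/
noncomputable def upperPar (q r y : ℂ) (a b : Fin 3 → ℂ) (i : Fin 4) (x : ℂ) : Fin 4 → ℂ :=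
  let e : Fin 3 → Fin 4 → ℂ := fun k =>
    ![r * b k / x, y * b k / a k, y * b k / a (k + 1), y * b k / a (k + 2)]
  ![![x * r / a 0, x * r / a 1, x * r / a 2, q / y], e 0, e 1, e 2] i

/-- The lower parameters of the series of the Jackson integral with index `i`. -/
noncomputable def lowerPar (q r y : ℂ) (b : Fin 3 → ℂ) (i : Fin 4) (x : ℂ) : Fin 3 → ℂ :=
  let e : Fin 3 → Fin 3 → ℂ := fun k =>
    ![y * r * b k / x, q * b k / b (k + 1), q * b k / b (k + 2)]
  ![![q * (x * r / y) / b 0, q * (x * r / y) / b 1, q * (x * r / y) / b 2], e 0, e 1, e 2] i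

/-- The factor `(q q^n;q)_∞` of the weight comes from `q s / b k` when the lattice starts at `b k`,
and from `y r s / x` when it starts at `x r / y`. -/
lemma phiWeight_par {q r y x : ℂ} {a b : Fin 3 → ℂ} (hr : r ^ 2 = q) (hy : y ≠ 0)
    (hx : x ≠ 0) (hb : ∀ k, b k ≠ 0) (i : Fin 4) (n : ℕ) :
    phiWeight q (upperPar q r y a b i x) (lowerPar q r y b i x) n =
      integrand q r y a b x (startPt r y b i x * q ^ n) := by
  have z0 : ∀ k, q * (b k * q ^ n) / b k = q * q ^ n := fun k => by
    have := hb k; field_simp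
  have z1 : r * (x * r / y * q ^ n) / x = q / y * q ^ n := by rw [← hr]; field_simp
  have z2 : y * r * (x * r / y * q ^ n) / x = q * q ^ n := by rw [← hr]; field_simp
  have z3 : ∀ c, y * (x * r / y * q ^ n) / c = x * r / c * q ^ n := fun c => by
    rw [show y * (x * r / y * q ^ n) = x * r * q ^ n by field_simp]; ring
  have z4 : ∀ c d, q * (d * q ^ n) / c = q * d / c * q ^ n := fun c d => by ring
  have z5 : ∀ c d, y * (d * q ^ n) / c = y * d / c * q ^ n := fun c d => by ring
  have z6 : ∀ k, r * (b k * q ^ n) / x = r * b k / x * q ^ n := fun k => by ring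
  have z7 : ∀ k, y * r * (b k * q ^ n) / x = y * r * b k / x * q ^ n := fun k => by ring
  fin_cases i <;>
  simp only [phiWeight, upperPar, lowerPar, startPt, integrand, integrandConst,
    Fin.prod_univ_three, Fin.prod_univ_four, Fin.zero_eta, Fin.mk_one, Fin.reduceFinMk,
    Matrix.cons_val, Fin.isValue, zero_add, Fin.reduceAdd, z0, z1, z2, z3, z6, z7] <;>
  simp only [z4, z5] <;> ring

lemma hasSum_jackson {q r y x : ℂ} (hq : ‖q‖ < 1) {a b : Fin 3 → ℂ} (hr : r ^ 2 = q)
    (hy : y ≠ 0) (hx : x ≠ 0) (hb : ∀ k, b k ≠ 0) (i : Fin 4)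
    (hd : PhiDefined q (upperPar q r y a b i x) (lowerPar q r y b i x)) :
    HasSum (fun n : ℕ => startPt r y b i x * q ^ n *
        integrand q r y a b x (startPt r y b i x * q ^ n))
      (startPt r y b i x * Phi q (upperPar q r y a b i x) (lowerPar q r y b i x)) := by
  have := (hasSum_Phi hq hd).mul_left (startPt r y b i x)
  simpa only [phiWeight_par hr hy hx hb, mul_assoc] using this

lemma operator_jackson_succ {q r y x : ℂ} (hq : ‖q‖ < 1) {a b : Fin 3 → ℂ} (hr : r ^ 2 = q)
    (hr0 : r ≠ 0) (hy : y ≠ 0) (hx : x ≠ 0) (ha : ∀ k, a k ≠ 0) (hb : ∀ k, b k ≠ 0)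
    (hab : a 0 * a 1 * a 2 * q = y ^ 2 * (b 0 * b 1 * b 2)) (j : Fin 3)
    (hd : ∀ z ∈ ({x / q, x, q * x} : Set ℂ),
      PhiDefined q (upperPar q r y a b j.succ z) (lowerPar q r y b j.succ z)) :
    (∏ k, (x - r * a k)) * (startPt r y b j.succ (x / q) *
        Phi q (upperPar q r y a b j.succ (x / q)) (lowerPar q r y b j.succ (x / q)))
      + q * (∏ k, (x - b k / r)) * (startPt r y b j.succ (q * x) *
        Phi q (upperPar q r y a b j.succ (q * x)) (lowerPar q r y b j.succ (q * x)))
      + midCoeff q r y x a b * (startPt r y b j.succ x *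
        Phi q (upperPar q r y a b j.succ x) (lowerPar q r y b j.succ x))
    = x * (b 0 * b 1 * b 2) * (1 - y) := by
  have hq0 : q ≠ 0 := by rw [← hr]; exact pow_ne_zero _ hr0
  have hs : ∀ z, startPt r y b j.succ z = b j := fun z => by fin_cases j <;> rfl
  have h1 := hasSum_jackson hq hr hy (div_ne_zero hx hq0) hb j.succ (hd (x / q) (by simp))
  have h2 := hasSum_jackson hq hr hy (mul_ne_zero hq0 hx) hb j.succ (hd (q * x) (by simp))
  have h3 := hasSum_jackson hq hr hy hx hb j.succ (hd x (by simp))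
  simp only [hs] at h1 h2 h3 ⊢
  have hT := ((h1.mul_left (∏ k, (x - r * a k))).add
    (h2.mul_left (q * ∏ k, (x - b k / r)))).add (h3.mul_left (midCoeff q r y x a b))
  -- The lower boundary term vanishes through the factor `1 - s / b j`.
  have hG0 : primitive q r y a b x (b j * q ^ 0) = 0 := by
    have : ∏ k, (1 - b j * q ^ 0 / b k) = 0 :=
      Finset.prod_eq_zero (Finset.mem_univ j) (by simp [hb j])
    simp only [primitive, this]
    ring
  rw [hasSum_eq_of_telescoping (G := fun n => primitive q r y a b x (b j * q ^ n)) hT ?_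
    (tendsto_primitive hq a b), hG0, sub_zero]
  intro n
  rw [operator_integrand hq hr hr0 hy hx ha hb hab, show q * (b j * q ^ n) = b j * q ^ (n + 1) by ring]
  · intro k
    apply qPochInf_ne_zero hq
    have hu : ∀ n : ℕ, y * b j / a k * q ^ n ≠ 1 := by
      have := (hd x (by simp)).1
      have e1 := this 1
      have e2 := this 2
      have e3 := this 3
      fin_cases j <;> fin_cases k <;> first | exact e1 | exact e2 | exact e3
    rw [show y * (b j * q ^ n) / a k = y * b j / a k * q ^ n by ring]
    exact mul_pow_ne_one_mul hu n
  · apply qPochInf_ne_zero hq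
    -- The denominator `s / (r x)` is the first upper parameter at the point `q x`.
    have hu : ∀ n : ℕ, r * b j / (q * x) * q ^ n ≠ 1 := by
      have := (hd (q * x) (by simp)).1 0
      fin_cases j <;> exact this
    rw [show b j * q ^ n / (r * x) = r * b j / (q * x) * q ^ n by rw [← hr]; field_simp]
    exact mul_pow_ne_one_mul hu n

/-- The general telescoping step is not available at `s = x r / y`: there `s / (r x) = 1 / y`, and
`y = 1` is not excluded. The first step is therefore done by hand. -/
lemma operator_jackson_zero {q r y x : ℂ} (hq : ‖q‖ < 1) {a b : Fin 3 → ℂ} (hr : r ^ 2 = q)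
    (hr0 : r ≠ 0) (hy : y ≠ 0) (hx : x ≠ 0) (ha : ∀ k, a k ≠ 0) (hb : ∀ k, b k ≠ 0)
    (hab : a 0 * a 1 * a 2 * q = y ^ 2 * (b 0 * b 1 * b 2))
    (hd : ∀ z ∈ ({x / q, x, q * x} : Set ℂ),
      PhiDefined q (upperPar q r y a b 0 z) (lowerPar q r y b 0 z)) :
    (∏ k, (x - r * a k)) * (startPt r y b 0 (x / q) *
        Phi q (upperPar q r y a b 0 (x / q)) (lowerPar q r y b 0 (x / q)))
      + q * (∏ k, (x - b k / r)) * (startPt r y b 0 (q * x) *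
        Phi q (upperPar q r y a b 0 (q * x)) (lowerPar q r y b 0 (q * x)))
      + midCoeff q r y x a b * (startPt r y b 0 x *
        Phi q (upperPar q r y a b 0 x) (lowerPar q r y b 0 x))
    = x * (b 0 * b 1 * b 2) * (1 - y) := by
  have hq0 : q ≠ 0 := by rw [← hr]; exact pow_ne_zero _ hr0
  have hs : ∀ z, startPt r y b 0 z = z * r / y := fun z => rfl
  have h1 := hasSum_jackson hq hr hy (div_ne_zero hx hq0) hb 0 (hd (x / q) (by simp))
  have h2 := hasSum_jackson hq hr hy (mul_ne_zero hq0 hx) hb 0 (hd (q * x) (by simp))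
  have h3 := hasSum_jackson hq hr hy hx hb 0 (hd x (by simp))
  simp only [hs] at h1 h2 h3 ⊢
  have hua : ∀ k, ∀ n : ℕ, x / q * r / a k * q ^ n ≠ 1 := by
    have := (hd (x / q) (by simp)).1
    have e0 := this 0
    have e1 := this 1
    have e2 := this 2
    intro k
    fin_cases k <;> first | exact e0 | exact e1 | exact e2
  have huy : ∀ n : ℕ, q / y * q ^ n ≠ 1 := (hd x (by simp)).1 3
  -- The lattice for `x`. The one for `x / q` has one extra point before `w 0`, contributing `i0`;
  -- the one for `q x` starts at `w 1`, so `T` is padded with a zero.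
  set w : ℕ → ℂ := fun n => x * r / y * q ^ n with hw
  have hwa : ∀ k n, y * w n / a k = x / q * r / a k * q ^ (n + 1) := fun k n => by
    simp only [hw]; have := ha k; field_simp; ring
  set A := ∏ k, (x - r * a k) with hA
  set B := ∏ k, (x - b k / r) with hB
  set C := midCoeff q r y x a b with hC
  set i0 : ℂ := x / q * r / y * integrand q r y a b (x / q) (x / q * r / y) with hi0
  have k1 : HasSum (fun n => w n * integrand q r y a b (x / q) (w n)) (x / q * r / y *
      Phi q (upperPar q r y a b 0 (x / q)) (lowerPar q r y b 0 (x / q)) - i0) := by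
    have := (hasSum_nat_add_iff' 1).2 h1
    rw [Finset.sum_range_one, pow_zero, mul_one] at this
    have hwn : ∀ n, x / q * r / y * q ^ (n + 1) = w n := fun n => by
      simp only [hw]; field_simp; ring
    simpa only [hwn] using this
  set T : ℕ → ℂ := fun n => if n = 0 then 0 else w n * integrand q r y a b (q * x) (w n) with hT
  have k2 : HasSum T (q * x * r / y *
      Phi q (upperPar q r y a b 0 (q * x)) (lowerPar q r y b 0 (q * x))) := by
    have : HasSum (fun n => T (n + 1)) (q * x * r / y *
        Phi q (upperPar q r y a b 0 (q * x)) (lowerPar q r y b 0 (q * x))) := by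
      have hwn : ∀ n, q * x * r / y * q ^ n = w (n + 1) := fun n => by simp only [hw]; ring
      simpa [hwn, hT] using h2
    simpa [hT] using (hasSum_nat_add_iff 1).1 this
  -- For `y ≠ 1`, `A * i0` is the value of `primitive` at `w 0`, with `1 - y` cancelled against `1 -
  -- 1 / y`; in this form it also makes sense for `y = 1`.
  set G : ℕ → ℂ := fun n => if n = 0 then A * i0 else primitive q r y a b x (w n) with hG
  have hGlim : Tendsto G atTop (𝓝 (x * (b 0 * b 1 * b 2) * (1 - y))) := by
    refine (tendsto_primitive (r := r) (s := x * r / y) hq a b).congr' ?_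
    filter_upwards [eventually_ne_atTop 0] with n hn
    simp [hG, hn, hw]
  have main := hasSum_eq_of_telescoping (G := G)
    (((k1.mul_left A).add (k2.mul_left (q * B))).add (h3.mul_left C)) ?_ hGlim
  · simp only [hG, if_true] at main
    linear_combination main
  rintro (_ | n)
  -- `p0` moves the constant factor from the extra point `w 0 / q` to `w 0`, and `p1` from `w 0` to
  -- `w 1`.
  · have p0 := integrandConst_step (b := b) (s := x / q * r / y) hq (y := y) (a := a) fun k => by
      apply qPochInf_ne_zero hq
      rw [show y * (x / q * r / y) / a k = x / q * r / a k by field_simp]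
      exact hua k
    have p1 := integrandConst_step (b := b) (s := x * r / y) hq (y := y) (a := a) fun k => by
      apply qPochInf_ne_zero hq
      have := hwa k 0
      simp only [hw, pow_zero, mul_one] at this
      rw [this]
      exact mul_pow_ne_one_mul (hua k) _
    rw [show q * (x / q * r / y) = x * r / y by field_simp] at p0
    have hAp : A = -((∏ k, (r * a k)) * ∏ k, (1 - y * (x / q * r / y) / a k)) := by
      rw [hA, ← Finset.prod_mul_distrib]
      simp only [Fin.prod_univ_three]
      have h (k) : x - r * a k = - (r * a k * (1 - y * (x / q * r / y) / a k)) := by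
        have := ha k
        rw [← hr]; field_simp; ring
      rw [h 0, h 1, h 2]; ring
    have hid := initial_identity hr hr0 hy hx ha hb hab
    rw [← hA, ← hC] at hid
    have q1 := qPochInf_step hq q
    have q2 := qPochInf_step hq (q / y)
    have hy1 : 1 - q / y ≠ 0 := sub_ne_zero.2 (by simpa using (huy 0).symm)
    have hy2 : qPochInf q (q * (q / y)) ≠ 0 := by
      apply qPochInf_ne_zero hq
      simpa [mul_comm] using mul_pow_ne_one_mul huy 1
    have hAi : A * i0 = -((∏ k, (r * a k)) * (x * r / y / q) * (∏ k, (1 - x * r / y / b k)) *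
        integrandConst q y a b (x * r / y) * (qPochInf q q / qPochInf q (q / y))) := by
      rw [hi0, integrand, show y * r * (x / q * r / y) / (x / q) = q by rw [← hr]; field_simp,
        show r * (x / q * r / y) / (x / q) = q / y by rw [← hr]; field_simp, hAp]
      linear_combination ((∏ k, (r * a k)) * (x * r / y / q) *
        (qPochInf q q / qPochInf q (q / y))) * p0
    simp only [hG, hT, if_true, zero_add, one_ne_zero, if_false, hw, pow_zero, mul_one, pow_one]
    rw [hAi, primitive, integrand, integrand,
      show y * r * (x * r / y) / (x / q) = q * q by rw [← hr]; field_simp,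
      show r * (x * r / y) / (x / q) = q * (q / y) by rw [← hr]; field_simp,
      show y * r * (x * r / y) / x = q by rw [← hr]; field_simp,
      show r * (x * r / y) / x = q / y by rw [← hr]; field_simp,
      show x * r / y * q = q * (x * r / y) by ring,
      show y * r * (q * (x * r / y)) / x = q * q by rw [← hr]; field_simp,
      show q * (x * r / y) / (r * x) = q / y by field_simp,
      mul_assoc (x * (b 0 * b 1 * b 2) * (1 - y)) (∏ k, (1 - q * (x * r / y) / b k)), p1, q1, q2]
    simp only [show ∀ k, y * (x * r / y) / a k = x * r / a k from fun k => by field_simp]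
    generalize integrandConst q y a b (x * r / y) = p at *
    generalize qPochInf q (q * q) = N at *
    generalize qPochInf q (q * (q / y)) = D at *
    generalize (∏ k, (1 - x * r / a k)) = X at *
    generalize (∏ k, (1 - x * r / y / b k)) = Y at *
    generalize (∏ k, (r * a k)) = Z at *
    generalize x * (b 0 * b 1 * b 2) * (1 - y) = c at *
    generalize x * r / y = s at *
    generalize 1 - q / y = E at *
    generalize s / q = s' at *
    clear_value A B C
    field_simp
    linear_combination p * N * hid
  · simp only [hG, hT, Nat.succ_ne_zero, if_false]
    rw [show w (n + 1 + 1) = q * w (n + 1) by simp only [hw]; ring,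
      ← operator_integrand hq hr hr0 hy hx ha hb hab]
    · intro k
      apply qPochInf_ne_zero hq
      rw [hwa]
      exact mul_pow_ne_one_mul (hua k) _
    · apply qPochInf_ne_zero hq
      -- From `w 1` on, the denominator involves only `q / y * q ^ n`, an upper parameter times a
      -- power of `q`.
      rw [show w (n + 1) / (r * x) = q / y * q ^ n by simp only [hw]; field_simp; ring]
      exact mul_pow_ne_one_mul huy n

lemma operator_jackson {q r y x : ℂ} (hq : ‖q‖ < 1) {a b : Fin 3 → ℂ} (hr : r ^ 2 = q)
    (hr0 : r ≠ 0) (hy : y ≠ 0) (hx : x ≠ 0) (ha : ∀ k, a k ≠ 0) (hb : ∀ k, b k ≠ 0)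
    (hab : a 0 * a 1 * a 2 * q = y ^ 2 * (b 0 * b 1 * b 2)) (i : Fin 4)
    (hd : ∀ z ∈ ({x / q, x, q * x} : Set ℂ),
      PhiDefined q (upperPar q r y a b i z) (lowerPar q r y b i z)) :
    (∏ k, (x - r * a k)) * (startPt r y b i (x / q) *
        Phi q (upperPar q r y a b i (x / q)) (lowerPar q r y b i (x / q)))
      + q * (∏ k, (x - b k / r)) * (startPt r y b i (q * x) *
        Phi q (upperPar q r y a b i (q * x)) (lowerPar q r y b i (q * x)))
      + midCoeff q r y x a b * (startPt r y b i x *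
        Phi q (upperPar q r y a b i x) (lowerPar q r y b i x))
    = x * (b 0 * b 1 * b 2) * (1 - y) := by
  induction i using Fin.cases with
  | zero => exact operator_jackson_zero hq hr hr0 hy hx ha hb hab hd
  | succ j => exact operator_jackson_succ hq hr hr0 hy hx ha hb hab j hd

/-! ### Powers of `q` -/

lemma qpow_add (τ a b : ℂ) : qpow τ (a + b) = qpow τ a * qpow τ b := by
  simp [qpow, add_mul, Complex.exp_add]

lemma qpow_neg (τ a : ℂ) : qpow τ (-a) = (qpow τ a)⁻¹ := by
  simp [qpow, Complex.exp_neg]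

lemma qpow_sub (τ a b : ℂ) : qpow τ (a - b) = qpow τ a / qpow τ b := by
  rw [sub_eq_add_neg, qpow_add, qpow_neg, div_eq_mul_inv]

lemma qpow_ne_zero (τ a : ℂ) : qpow τ a ≠ 0 := Complex.exp_ne_zero _

lemma qpow_one (τ : ℂ) : qpow τ 1 = Complex.exp τ := by simp [qpow]

lemma qpow_half_sq (τ : ℂ) : qpow τ (1 / 2) ^ 2 = Complex.exp τ := by
  rw [← qpow_one, sq, ← qpow_add]; norm_num

lemma qpow_three_halves (τ : ℂ) : qpow τ (3 / 2) = Complex.exp τ * qpow τ (1 / 2) := by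
  rw [← qpow_one, ← qpow_add]; norm_num

/-! ### The equation and the functions in terms of Jackson integrals -/

/-- The definition of `λ` is exactly this balancing condition. -/
lemma prod_qpow_mul_eq (τ : ℂ) (h l t : Fin 3 → ℂ) :
    qpow τ (h 0) * t 0 * (qpow τ (h 1) * t 1) * (qpow τ (h 2) * t 2) * Complex.exp τ =
      qpow τ (lam h l) ^ 2 *
        (qpow τ (l 0) * t 0 * (qpow τ (l 1) * t 1) * (qpow τ (l 2) * t 2)) := by
  have : qpow τ (h 0) * qpow τ (h 1) * qpow τ (h 2) * qpow τ 1 =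
      qpow τ (lam h l) ^ 2 * (qpow τ (l 0) * qpow τ (l 1) * qpow τ (l 2)) := by
    simp only [sq, ← qpow_add]
    congr 1
    simp only [lam]; ring
  rw [qpow_one] at this
  linear_combination (t 0 * t 1 * t 2) * this

lemma solvesDegThree_iff (τ α : ℂ) {h l t : Fin 3 → ℂ} (ht : ∀ k, t k ≠ 0) (g : ℂ → ℂ) (u : ℂ) :
    SolvesDegThree (Complex.exp τ) τ α h l t g u ↔
      (∏ k, (Complex.exp u - qpow τ (1 / 2) * (qpow τ (h k) * t k))) * g (u - τ)
        + qpow τ α ^ 2 * Complex.exp τ *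
          (∏ k, (Complex.exp u - qpow τ (l k) * t k / qpow τ (1 / 2))) * g (u + τ)
        + qpow τ α * midCoeff (Complex.exp τ) (qpow τ (1 / 2)) (qpow τ (lam h l)) (Complex.exp u)
          (fun k => qpow τ (h k) * t k) (fun k => qpow τ (l k) * t k) * g u = 0 := by
  have h0 := ht 0
  have h1 := ht 1
  have h2 := ht 2
  have e1 : qpow τ ((h 0 + h 1 + h 2 + l 0 + l 1 + l 2 + 1) / 2) =
      qpow τ (lam h l) * (qpow τ (l 0) * qpow τ (l 1) * qpow τ (l 2)) := by
    simp only [← qpow_add]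
    congr 1
    simp only [lam]; ring
  have e2 : qpow τ ((h 0 + h 1 + h 2 + l 0 + l 1 + l 2) / 2) =
      qpow τ (lam h l) * (qpow τ (l 0) * qpow τ (l 1) * qpow τ (l 2)) / qpow τ (1 / 2) := by
    simp only [← qpow_add, ← qpow_sub]
    congr 1
    simp only [lam]; ring
  have e3 : qpow τ (2 * α + 1) = qpow τ α ^ 2 * Complex.exp τ := by
    rw [qpow_add, two_mul, qpow_add, qpow_one, sq]
  have hC : midCoeff (Complex.exp τ) (qpow τ (1 / 2)) (qpow τ (lam h l)) (Complex.exp u)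
          (fun k => qpow τ (h k) * t k) (fun k => qpow τ (l k) * t k) =
      -(Complex.exp τ + 1) * Complex.exp u ^ 3
        + qpow τ (1 / 2) *
          ((qpow τ (h 0) + qpow τ (l 0)) * t 0 + (qpow τ (h 1) + qpow τ (l 1)) * t 1
            + (qpow τ (h 2) + qpow τ (l 2)) * t 2) * Complex.exp u ^ 2
        - qpow τ ((h 0 + h 1 + h 2 + l 0 + l 1 + l 2 + 1) / 2) *
          ((qpow τ (-h 0) + qpow τ (-l 0)) * t 1 * t 2
            + (qpow τ (-h 1) + qpow τ (-l 1)) * t 0 * t 2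
            + (qpow τ (-h 2) + qpow τ (-l 2)) * t 0 * t 1) * Complex.exp u
        + qpow τ ((h 0 + h 1 + h 2 + l 0 + l 1 + l 2) / 2) * (Complex.exp τ + 1)
          * t 0 * t 1 * t 2 := by
    have n := qpow_ne_zero τ
    have n0 := n (h 0)
    have n1 := n (h 1)
    have n2 := n (h 2)
    have n3 := n (l 0)
    have n4 := n (l 1)
    have n5 := n (l 2)
    have n6 := n (1 / 2)
    rw [e1, e2]
    simp only [midCoeff, qpow_neg]
    generalize qpow τ (1 / 2) = r at *
    field_simp
  simp only [SolvesDegThree]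
  rw [← hC, e3]
  simp only [qpow_add, qpow_sub, Fin.prod_univ_three]
  refine Eq.congr_left ?_
  ring

lemma upper1_eq (τ : ℂ) (h l : Fin 3 → ℂ) {t : Fin 3 → ℂ} (ht : ∀ k, t k ≠ 0) (i : Fin 4) (u : ℂ) :
    upper1 τ h l t i u = upperPar (Complex.exp τ) (qpow τ (1 / 2)) (qpow τ (lam h l))
      (fun k => qpow τ (h k) * t k) (fun k => qpow τ (l k) * t k) i (Complex.exp u) := by
  have n := qpow_ne_zero τ
  have h0 := ht 0
  have h1 := ht 1
  have h2 := ht 2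
  ext k
  fin_cases i <;> fin_cases k <;>
  simp only [upper1, upperPar, Fin.zero_eta, Fin.mk_one, Fin.reduceFinMk, Matrix.cons_val,
    Fin.isValue, zero_add, Fin.reduceAdd, qpow_add, qpow_sub, qpow_neg, qpow_one] <;>
  field_simp

lemma lower1_eq (τ : ℂ) (h l t : Fin 3 → ℂ) (i : Fin 4) (u : ℂ) :
    lower1 τ h l t i u = lowerPar (Complex.exp τ) (qpow τ (1 / 2)) (qpow τ (lam h l))
      (fun k => qpow τ (l k) * t k) i (Complex.exp u) := by
  ext k
  fin_cases i <;> fin_cases k <;>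
  simp only [lower1, lowerPar, Fin.zero_eta, Fin.mk_one, Fin.reduceFinMk, Matrix.cons_val,
    Fin.isValue, zero_add, Fin.reduceAdd, qpow_add, qpow_sub, qpow_neg, qpow_one,
    qpow_three_halves] <;>
  field_simp

lemma factor1_eq (τ α : ℂ) (h l t : Fin 3 → ℂ) (i : Fin 4) (u : ℂ) :
    factor1 τ α h l t i u = Complex.exp (-α * u) / qpow τ (1 / 2) *
      startPt (qpow τ (1 / 2)) (qpow τ (lam h l)) (fun k => qpow τ (l k) * t k) i
        (Complex.exp u) := by
  have n := qpow_ne_zero τ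
  have n6 := n (1 / 2)
  have e : Complex.exp ((1 - α) * u) = Complex.exp (-α * u) * Complex.exp u := by
    rw [← Complex.exp_add]; ring_nf
  fin_cases i <;>
  simp only [factor1, startPt, Fin.zero_eta, Fin.mk_one, Fin.reduceFinMk, Matrix.cons_val,
    Fin.isValue, qpow_sub, qpow_neg, e] <;>
  generalize qpow τ (1 / 2) = r at * <;>
  field_simp

/-- The factor `x^(-α)` turns the shifts into powers of `q^α`, so the operator becomes `q^α` times
the one for Jackson sums. The right side does not involve `i`. -/
lemma operator_g1 {q τ : ℂ} (hq : ‖q‖ < 1) (hτ : Complex.exp τ = q) (α : ℂ) {h l t : Fin 3 → ℂ}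
    (ht : ∀ k, t k ≠ 0) (i : Fin 4) (u : ℂ)
    (hd : ∀ v ∈ ({u - τ, u, u + τ} : Set ℂ), Defined1 q τ h l t i v) :
    (∏ k, (Complex.exp u - qpow τ (1 / 2) * (qpow τ (h k) * t k))) * g1 q τ α h l t i (u - τ)
      + qpow τ α ^ 2 * q *
        (∏ k, (Complex.exp u - qpow τ (l k) * t k / qpow τ (1 / 2))) * g1 q τ α h l t i (u + τ)
      + qpow τ α * midCoeff q (qpow τ (1 / 2)) (qpow τ (lam h l)) (Complex.exp u)
        (fun k => qpow τ (h k) * t k) (fun k => qpow τ (l k) * t k) * g1 q τ α h l t i u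
    = qpow τ α * (Complex.exp (-α * u) / qpow τ (1 / 2)) *
      (Complex.exp u * (qpow τ (l 0) * t 0 * (qpow τ (l 1) * t 1) * (qpow τ (l 2) * t 2)) *
        (1 - qpow τ (lam h l))) := by
  subst hτ
  have n := qpow_ne_zero τ
  simp only [Defined1, upper1_eq _ _ _ ht, lower1_eq] at hd
  have hm : Complex.exp (u - τ) = Complex.exp u / Complex.exp τ := Complex.exp_sub _ _
  have hp : Complex.exp (u + τ) = Complex.exp τ * Complex.exp u := by
    rw [add_comm, Complex.exp_add]
  have main := operator_jackson (a := fun k => qpow τ (h k) * t k)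
    (b := fun k => qpow τ (l k) * t k) hq (qpow_half_sq τ) (n _) (n (lam h l))
    (Complex.exp_ne_zero u) (fun k => mul_ne_zero (n _) (ht k)) (fun k => mul_ne_zero (n _) (ht k))
    (prod_qpow_mul_eq τ h l t) i (by
      rintro z (rfl | rfl | rfl)
      · simpa only [hm] using hd (u - τ) (by simp)
      · exact hd u (by simp)
      · simpa only [hp] using hd (u + τ) (by simp))
  have em : Complex.exp (-α * (u - τ)) = Complex.exp (-α * u) * qpow τ α := by
    rw [qpow, ← Complex.exp_add]; ring_nf
  have ep : Complex.exp (-α * (u + τ)) = Complex.exp (-α * u) / qpow τ α := by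
    rw [qpow, ← Complex.exp_sub]; ring_nf
  have nα := n α
  simp only [g1, upper1_eq _ _ _ ht, lower1_eq, factor1_eq, em, ep, hm, hp]
  rw [← main]
  field_simp

lemma solvesDegThree_sub_g1 {q τ : ℂ} (hq : ‖q‖ < 1) (hτ : Complex.exp τ = q) (α : ℂ)
    {h l t : Fin 3 → ℂ} (ht : ∀ k, t k ≠ 0) (i j : Fin 4) (u : ℂ)
    (hd : ∀ v ∈ ({u - τ, u, u + τ} : Set ℂ), Defined1 q τ h l t i v ∧ Defined1 q τ h l t j v) :
    SolvesDegThree q τ α h l t (fun v => g1 q τ α h l t i v - g1 q τ α h l t j v) u := by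
  have hi := operator_g1 hq hτ α ht i u fun v hv => (hd v hv).1
  have hj := operator_g1 hq hτ α ht j u fun v hv => (hd v hv).2
  subst hτ
  rw [solvesDegThree_iff τ α ht]
  linear_combination hi - hj

/-! ### The inversion `x ↦ 1 / x` -/

lemma lam_inversion (h l : Fin 3 → ℂ) : lam (-l) (-h) = lam h l := by
  simp only [lam, Pi.neg_apply]; ring

lemma upper2_eq (τ : ℂ) (h l t : Fin 3 → ℂ) (i : Fin 4) (u : ℂ) :
    upper2 τ h l t i u = upper1 τ (-l) (-h) t⁻¹ i (-u) := by
  have n := qpow_ne_zero τ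
  ext k
  fin_cases i <;> fin_cases k <;>
  simp only [upper1, upper2, lam_inversion, Fin.zero_eta, Fin.mk_one, Fin.reduceFinMk,
    Matrix.cons_val, Fin.isValue, zero_add, Fin.reduceAdd, qpow_add, qpow_sub, qpow_neg, qpow_one,
    Pi.neg_apply, Pi.inv_apply, neg_neg, Complex.exp_neg] <;>
  field_simp

lemma lower2_eq (τ : ℂ) (h l t : Fin 3 → ℂ) (i : Fin 4) (u : ℂ) :
    lower2 τ h l t i u = lower1 τ (-l) (-h) t⁻¹ i (-u) := by
  have n := qpow_ne_zero τ
  ext k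
  fin_cases i <;> fin_cases k <;>
  simp only [lower1, lower2, lam_inversion, Fin.zero_eta, Fin.mk_one, Fin.reduceFinMk,
    Matrix.cons_val, Fin.isValue, zero_add, Fin.reduceAdd, qpow_add, qpow_sub, qpow_neg, qpow_one,
    Pi.neg_apply, Pi.inv_apply, Complex.exp_neg, qpow_three_halves] <;>
  field_simp

lemma factor2_eq (τ α : ℂ) (h l t : Fin 3 → ℂ) (i : Fin 4) (u : ℂ) :
    factor2 τ α h l t i u =
      qpow τ (lam h l) * factor1 τ (lam h l - α) (-l) (-h) t⁻¹ i (-u) := by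
  have n := qpow_ne_zero τ
  have nl := n (lam h l)
  have e1 : Complex.exp ((1 - (lam h l - α)) * -u) = Complex.exp ((lam h l - α - 1) * u) := by
    ring_nf
  have e2 : Complex.exp (-(lam h l - α) * -u) = Complex.exp ((lam h l - α) * u) := by
    ring_nf
  fin_cases i <;>
  simp only [factor1, factor2, lam_inversion, Fin.zero_eta, Fin.mk_one, Fin.reduceFinMk,
    Matrix.cons_val, Fin.isValue, qpow_sub, qpow_neg, Pi.neg_apply, Pi.inv_apply, e1, e2] <;>
  field_simp

lemma g2_eq (q τ α : ℂ) (h l t : Fin 3 → ℂ) (i : Fin 4) (u : ℂ) :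
    g2 q τ α h l t i u =
      qpow τ (lam h l) * g1 q τ (lam h l - α) (-l) (-h) t⁻¹ i (-u) := by
  simp only [g1, g2, upper2_eq, lower2_eq, factor2_eq, mul_assoc]

/-- Under the inversion `a` and `b` become `b⁻¹` and `a⁻¹`. Together with the two product formulas
that follow, this shows that the three coefficients change by compatible factors. -/
lemma midCoeff_inversion {q r y x : ℂ} {a b : Fin 3 → ℂ} (hr : r ^ 2 = q) (hr0 : r ≠ 0)
    (hy : y ≠ 0) (hx : x ≠ 0) (ha : ∀ k, a k ≠ 0) (hb : ∀ k, b k ≠ 0)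
    (hab : a 0 * a 1 * a 2 * q = y ^ 2 * (b 0 * b 1 * b 2)) :
    midCoeff q r y x⁻¹ b⁻¹ a⁻¹ =
      -(y * q / (x ^ 3 * r ^ 3 * (a 0 * a 1 * a 2))) * midCoeff q r y x a b := by
  have h0 := ha 0
  have h1 := ha 1
  have h2 := ha 2
  have g0 := hb 0
  have g1 := hb 1
  have g2 := hb 2
  subst hr
  have e : b 0 = a 0 * a 1 * a 2 * r ^ 2 / (y ^ 2 * b 1 * b 2) := by
    field_simp; linear_combination - hab
  simp only [midCoeff, Pi.inv_apply]
  rw [e]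
  clear e hab
  field_simp
  ring

lemma prod_sub_mul_inv {r x : ℂ} {b : Fin 3 → ℂ} (hr0 : r ≠ 0) (hx : x ≠ 0)
    (hb : ∀ k, b k ≠ 0) :
    ∏ k, (x⁻¹ - r * (b k)⁻¹) = -(r ^ 3 / (x ^ 3 * (b 0 * b 1 * b 2))) * ∏ k, (x - b k / r) := by
  have h0 := hb 0
  have h1 := hb 1
  have h2 := hb 2
  simp only [Fin.prod_univ_three]
  field_simp
  ring

lemma prod_sub_inv_div {r x : ℂ} {a : Fin 3 → ℂ} (hr0 : r ≠ 0) (hx : x ≠ 0)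
    (ha : ∀ k, a k ≠ 0) :
    ∏ k, (x⁻¹ - (a k)⁻¹ / r) = -(1 / (x ^ 3 * r ^ 3 * (a 0 * a 1 * a 2))) *
      ∏ k, (x - r * a k) := by
  have h0 := ha 0
  have h1 := ha 1
  have h2 := ha 2
  simp only [Fin.prod_univ_three]
  field_simp
  ring

lemma solvesDegThree_inversion (τ α : ℂ) {h l t : Fin 3 → ℂ} (ht : ∀ k, t k ≠ 0) (g : ℂ → ℂ)
    (u : ℂ) (hg : SolvesDegThree (Complex.exp τ) τ (lam h l - α) (-l) (-h) t⁻¹ g (-u)) :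
    SolvesDegThree (Complex.exp τ) τ α h l t (fun v => qpow τ (lam h l) * g (-v)) u := by
  have n := qpow_ne_zero τ
  rw [solvesDegThree_iff (t := t⁻¹) τ _ (fun k => inv_ne_zero (ht k)), lam_inversion] at hg
  rw [solvesDegThree_iff τ α ht]
  have hab := prod_qpow_mul_eq τ h l t
  have hr := qpow_half_sq τ
  have hr0 := n (1 / 2)
  have ha : ∀ k, qpow τ (h k) * t k ≠ 0 := fun k => mul_ne_zero (n _) (ht k)
  have hb : ∀ k, qpow τ (l k) * t k ≠ 0 := fun k => mul_ne_zero (n _) (ht k)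
  have hx := Complex.exp_ne_zero u
  have hy := n (lam h l)
  have hα := n α
  have hC := midCoeff_inversion (a := fun k => qpow τ (h k) * t k)
    (b := fun k => qpow τ (l k) * t k) hr hr0 hy hx ha hb hab
  have ea : (fun k => qpow τ ((-h) k) * t⁻¹ k) = (fun k => qpow τ (h k) * t k)⁻¹ := by
    ext k; simp [qpow_neg, mul_comm]
  have eb : (fun k => qpow τ ((-l) k) * t⁻¹ k) = (fun k => qpow τ (l k) * t k)⁻¹ := by
    ext k; simp [qpow_neg, mul_comm]
  have ea' : ∀ k, qpow τ ((-h) k) * t⁻¹ k = (qpow τ (h k) * t k)⁻¹ := congrFun ea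
  have eb' : ∀ k, qpow τ ((-l) k) * t⁻¹ k = (qpow τ (l k) * t k)⁻¹ := congrFun eb
  rw [ea, eb, Complex.exp_neg, hC, show -u - τ = -(u + τ) by ring,
    show -u + τ = -(u - τ) by ring, qpow_sub] at hg
  simp only [ea', eb'] at hg
  rw [prod_sub_mul_inv (b := fun k => qpow τ (l k) * t k) hr0 hx hb,
    prod_sub_inv_div (a := fun k => qpow τ (h k) * t k) hr0 hx ha] at hg
  have he : qpow τ (l 0) * t 0 * (qpow τ (l 1) * t 1) * (qpow τ (l 2) * t 2) =
      qpow τ (h 0) * t 0 * (qpow τ (h 1) * t 1) * (qpow τ (h 2) * t 2) * Complex.exp τ /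
        qpow τ (lam h l) ^ 2 := by
    rw [hab]; field_simp
  have hE : qpow τ (h 0) * t 0 * (qpow τ (h 1) * t 1) * (qpow τ (h 2) * t 2) ≠ 0 :=
    mul_ne_zero (mul_ne_zero (ha 0) (ha 1)) (ha 2)
  simp only [he, ← hr] at hg
  simp only [← hr]
  clear ea eb ea' eb' hC hab he ha hb
  generalize midCoeff (qpow τ (1 / 2) ^ 2) (qpow τ (1 / 2)) (qpow τ (lam h l)) (Complex.exp u)
    (fun k => qpow τ (h k) * t k) (fun k => qpow τ (l k) * t k) = C at *
  generalize ∏ k, (Complex.exp u - qpow τ (1 / 2) * (qpow τ (h k) * t k)) = A at *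
  generalize ∏ k, (Complex.exp u - qpow τ (l k) * t k / qpow τ (1 / 2)) = B at *
  generalize qpow τ (h 0) * t 0 * (qpow τ (h 1) * t 1) * (qpow τ (h 2) * t 2) = E at *
  generalize g (-(u - τ)) = G₁ at *
  generalize g (-(u + τ)) = G₂ at *
  generalize g (-u) = G₃ at *
  generalize qpow τ (1 / 2) = r at *
  generalize qpow τ (lam h l) = y at *
  generalize qpow τ α = Q at *
  generalize Complex.exp u = x at *
  -- The common factor between the inverted equation and the original one, once `b₀ b₁ b₂` is
  -- written through `E = a₀ a₁ a₂`.
  have hk : -(y / (Q ^ 2 * x ^ 3 * r * E)) ≠ 0 := by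
    simp_all
  refine (mul_eq_zero_iff_left hk).1 ?_
  rw [← hg]
  field_simp
  ring

theorem corollary4p11
    (q τ : ℂ) (hq0 : 0 < ‖q‖) (hq1 : ‖q‖ < 1) (hτ : Complex.exp τ = q)
    (α : ℂ) (h l t : Fin 3 → ℂ) (ht : ∀ k, t k ≠ 0) :
    (∀ i j : Fin 4, ∀ u : ℂ,
      (∀ v ∈ ({u - τ, u, u + τ} : Set ℂ),
        QHyp.Defined1 q τ h l t i v ∧ QHyp.Defined1 q τ h l t j v) →
      QHyp.SolvesDegThree q τ α h l t
        (fun v => QHyp.g1 q τ α h l t i v - QHyp.g1 q τ α h l t j v) u) ∧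
    (∀ i j : Fin 4, ∀ u : ℂ,
      (∀ v ∈ ({u - τ, u, u + τ} : Set ℂ),
        QHyp.Defined2 q τ h l t i v ∧ QHyp.Defined2 q τ h l t j v) →
      QHyp.SolvesDegThree q τ α h l t
        (fun v => QHyp.g2 q τ α h l t i v - QHyp.g2 q τ α h l t j v) u) := by
  refine ⟨fun i j u hd => solvesDegThree_sub_g1 hq1 hτ α ht i j u hd, fun i j u hd => ?_⟩
  have key := solvesDegThree_sub_g1 hq1 hτ (lam h l - α) (h := -l) (l := -h) (t := t⁻¹)
    (fun k => inv_ne_zero (ht k)) i j (-u) (fun v hv => by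
      have := hd (-v) (by
        rcases hv with rfl | rfl | rfl
        · right; right; change -(-u - τ) = u + τ; ring
        · right; left; simp
        · left; ring)
      simpa only [Defined1, Defined2, upper2_eq, lower2_eq, neg_neg] using this)
  subst hτ
  simpa only [g2_eq, mul_sub] using solvesDegThree_inversion τ α ht _ u key
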